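/- A topological group $G$ is called simply $sm$-factorizable if for every co-zero set $U$ in $G$ there is a continuous homomorphism $\pi$ of $G$ onto a separable metrizable topological group $H$ with $\pi^{-1}(\pi(U))=U$. For a Hausdorff topological group $G$, let $\mu G$ be the Dieudonné completion of $G$ (the completion with respect to the finest uniformity compatible with the topology of $G$), let $\upsilon G$ be the Hewitt–Nachbin realcompactification of $G$ (the closure of the canonical image of $G$ in $\mathbb{R}^{C(G)}$, where $C(G)$ is the set of continuous functions $G\to\mathbb{R}$), let $\varrho G$ be the Raĭkov completion of $G$ (the completion with respect to the two-sided uniformity), and let $\varrho_\omega G$ be the $G_\delta$-closure of $G$ in $\varrho G$, that is, the set of all $x\in\varrho G$ such that every $G_\delta$-set of $\varrho G$ containing $x$ meets $G$. Theorem. Let $G$ be a Hausdorff simply $sm$-factorizable topological group. Then $\mu G=\varrho_\omega G=\upsilon G$, in the sense that there are homeomorphisms $\mu G\to\varrho_\omega G$ and $\varrho_\omega G\to\upsilon G$ compatible with the canonical maps of $G$ into these spaces. Consequently, $G$ is completion friendly: the canonical map $G\to\varrho_\omega G$ is a topological embedding and every continuous function $f\colon G\to\mathbb{R}$ extends to a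 continuous function $\varrho_\omega G\to\mathbb{R}$. Moreover, $G$ is a $PT$-group: the multiplication and the inversion of $G$ extend to continuous maps $\mu G\times\mu G\to\mu G$ and $\mu G\to\mu G$. -/

import Mathlib

namespace SMFactor

open Set

universe u

/-- A co-zero set of `X`: the complement of the zero set of a continuous real-valued function. -/
def IsCozero {X : Type u} [TopologicalSpace X] (U : Set X) : Prop :=
  ∃ f : X → ℝ, Continuous f ∧ U = {x | f x ≠ 0}

/-- A topological group `G` is simply `sm`-factorizable if for every co-zero set `U` of `G` there is
a continuous homomorphism `π` of `G` onto a separable metrizable topological group `H` with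
`π ⁻¹ (π U) = U`. (As `H` is an image of `G`, taking `H` in the universe of `G` is no loss.) -/
def IsSimplySMFactorizable (G : Type u) [Group G] [TopologicalSpace G] : Prop :=
  ∀ U : Set G, IsCozero U →
    ∃ (H : Type u) (_ : Group H) (_ : TopologicalSpace H) (π : G →* H),
      IsTopologicalGroup H ∧ TopologicalSpace.SeparableSpace H ∧
      TopologicalSpace.MetrizableSpace H ∧
      Continuous π ∧ Function.Surjective π ∧ π ⁻¹' (π '' U) = U

/-- `Y` is `G_δ`-dense in the space `X`: every nonempty `G_δ`-set of `X` meets `Y`. -/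
def IsGDeltaDense {X : Type u} [TopologicalSpace X] (Y : Set X) : Prop :=
  ∀ s : Set X, IsGδ s → s.Nonempty → (s ∩ Y).Nonempty

/-- The `G_δ`-closure of `Y` in `X`: the points all of whose `G_δ`-neighbourhoods meet `Y`. By
`isGreatest_gDeltaClosure` it is the biggest subset of `X` containing `Y` as a `G_δ`-dense
subset. -/
def gDeltaClosure {X : Type u} [TopologicalSpace X] (Y : Set X) : Set X :=
  {x | ∀ s : Set X, IsGδ s → x ∈ s → (s ∩ Y).Nonempty}

theorem subset_gDeltaClosure {X : Type u} [TopologicalSpace X] (Y : Set X) :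
    Y ⊆ gDeltaClosure Y := fun x hx _ _ hxs => ⟨x, hxs, hx⟩

theorem isGreatest_gDeltaClosure {X : Type u} [TopologicalSpace X] (Y : Set X) :
    IsGreatest {Z : Set X | Y ⊆ Z ∧ IsGDeltaDense ((fun z : Z => (z : X)) ⁻¹' Y)}
      (gDeltaClosure Y) := by
  refine ⟨⟨subset_gDeltaClosure Y, ?_⟩, ?_⟩
  · rintro s hs ⟨z, hz⟩
    obtain ⟨T, hTo, hTc, rfl⟩ := hs
    choose! V hVo hV using fun t (ht : t ∈ T) => isOpen_induced_iff.1 (hTo t ht)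
    obtain ⟨y, hy, hyY⟩ := z.2 (⋂ t ∈ T, V t)
      (IsGδ.biInter_of_isOpen hTc hVo) (by
        simp only [mem_iInter]
        intro t ht
        have h := hz t ht
        rw [← hV t ht] at h
        exact h)
    refine ⟨⟨y, subset_gDeltaClosure Y hyY⟩, ?_, hyY⟩
    intro t ht
    rw [← hV t ht]
    simp only [mem_iInter] at hy
    exact hy t ht
  · rintro Z ⟨-, hZ⟩ x hx s hs hxs
    obtain ⟨z, hz, hzY⟩ := hZ ((fun z : Z => (z : X)) ⁻¹' s)
      (hs.preimage continuous_subtype_val) ⟨⟨x, hx⟩, hxs⟩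
    exact ⟨z, hz, hzY⟩

/-- The two-sided (Raĭkov) uniformity of a topological group: the coarsest uniformity finer than
both the left and the right uniformity. -/
abbrev twoSidedUniformSpace (G : Type u) [Group G] [TopologicalSpace G] [IsTopologicalGroup G] :
    UniformSpace G :=
  IsTopologicalGroup.leftUniformSpace G ⊓ IsTopologicalGroup.rightUniformSpace G

theorem twoSidedUniformSpace_toTopologicalSpace (G : Type u) [Group G] [t : TopologicalSpace G]
    [IsTopologicalGroup G] : (twoSidedUniformSpace G).toTopologicalSpace = t :=
  inf_idem t

/-- The Raĭkov completion `ϱG` (as a space): the Hausdorff completion of `G` with respect to the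
two-sided uniformity. -/
def RaikovCompletion (G : Type u) [Group G] [TopologicalSpace G] [IsTopologicalGroup G] : Type u :=
  @UniformSpace.Completion G (twoSidedUniformSpace G)

instance (G : Type u) [Group G] [TopologicalSpace G] [IsTopologicalGroup G] :
    UniformSpace (RaikovCompletion G) :=
  @UniformSpace.Completion.uniformSpace G (twoSidedUniformSpace G)

/-- The canonical map `G → ϱG`. -/
def toRaikov (G : Type u) [Group G] [TopologicalSpace G] [IsTopologicalGroup G] :
    G → RaikovCompletion G :=
  @UniformSpace.Completion.coe' G (twoSidedUniformSpace G)

/-- `ϱ_ωG`: the `G_δ`-closure of `G` in its Raĭkov completion, with the subspace topology. -/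
abbrev RaikovOmega (G : Type u) [Group G] [TopologicalSpace G] [IsTopologicalGroup G] : Type u :=
  gDeltaClosure (range (toRaikov G))

/-- The canonical map `G → ϱ_ωG`. -/
def toRaikovOmega (G : Type u) [Group G] [TopologicalSpace G] [IsTopologicalGroup G] :
    G → RaikovOmega G :=
  fun x => ⟨toRaikov G x, subset_gDeltaClosure _ (mem_range_self x)⟩

/-- The fine (universal) uniformity of a completely regular space: the finest uniformity inducing
its topology. (In Mathlib's order on uniformities, the finest is the infimum.) -/
abbrev fineUniformSpace (X : Type u) [t : TopologicalSpace X] : UniformSpace X :=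
  sInf {v : UniformSpace X | v.toTopologicalSpace = t}

theorem fineUniformSpace_toTopologicalSpace (X : Type u) [t : TopologicalSpace X]
    [CompletelyRegularSpace X] : (fineUniformSpace X).toTopologicalSpace = t := by
  obtain ⟨v, hv⟩ := CompletelyRegularSpace.exists_uniformSpace (X := X)
  rw [UniformSpace.toTopologicalSpace_sInf]
  apply le_antisymm
  · exact iInf₂_le_of_le v hv (le_of_eq hv)
  · exact le_iInf₂ fun w hw => le_of_eq (Eq.symm hw)

/-- The Dieudonné completion `μX` of a completely regular space: the Hausdorff completion of `X`
with respect to its fine uniformity. -/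
def DieudonneCompletion (X : Type u) [TopologicalSpace X] : Type u :=
  @UniformSpace.Completion X (fineUniformSpace X)

instance (X : Type u) [TopologicalSpace X] : UniformSpace (DieudonneCompletion X) :=
  @UniformSpace.Completion.uniformSpace X (fineUniformSpace X)

/-- The canonical map `X → μX`. -/
def toDieudonne (X : Type u) [TopologicalSpace X] : X → DieudonneCompletion X :=
  @UniformSpace.Completion.coe' X (fineUniformSpace X)

/-- The evaluation map of `X` into the power `ℝ^C(X)`. -/
def evalMap (X : Type u) [TopologicalSpace X] : X → (C(X, ℝ) → ℝ) := fun x f => f x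

/-- The Hewitt–Nachbin realcompactification `υX` of a completely regular space: the closure of the
canonical image of `X` in `ℝ^C(X)`, with the subspace topology. -/
abbrev Realcompactification (X : Type u) [TopologicalSpace X] : Type u :=
  closure (range (evalMap X))

/-- The canonical map `X → υX`. -/
def toRealcompactification (X : Type u) [TopologicalSpace X] : X → Realcompactification X :=
  fun x => ⟨evalMap X x, subset_closure (mem_range_self x)⟩

/-- `X` is `C`-embedded in `Y` through `i`: `i` is a topological embedding and every continuous
real-valued function on `X` extends to a continuous function on `Y`. -/
def IsCEmbedding {X Y : Type u} [TopologicalSpace X] [TopologicalSpace Y] (i : X → Y) : Prop :=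
  Topology.IsEmbedding i ∧
    ∀ f : X → ℝ, Continuous f → ∃ g : Y → ℝ, Continuous g ∧ ∀ x, g (i x) = f x

/-- `G` is completion friendly: `G` is `C`-embedded in `ϱ_ωG`. -/
def IsCompletionFriendly (G : Type u) [Group G] [TopologicalSpace G] [IsTopologicalGroup G] :
    Prop :=
  IsCEmbedding (toRaikovOmega G)

/-- `G` is a `PT`-group: multiplication and inversion of `G` extend continuously to `μG`. -/
def IsPTGroup (G : Type u) [Group G] [TopologicalSpace G] : Prop :=
  (∃ m : DieudonneCompletion G × DieudonneCompletion G → DieudonneCompletion G, Continuous m ∧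
      ∀ x y : G, m (toDieudonne G x, toDieudonne G y) = toDieudonne G (x * y)) ∧
    ∃ j : DieudonneCompletion G → DieudonneCompletion G, Continuous j ∧
      ∀ x : G, j (toDieudonne G x) = toDieudonne G x⁻¹

end SMFactor

/-!
A point of any of the three completions is determined by the trace on `G` of its neighbourhood
filter, so it suffices to compare the traces. Simple `sm`-factorizability makes every continuous
real-valued function factor through a quotient group `G ⧸ N` with a coarser separable metrizable
topology. On such a quotient a two-sided Cauchy filter with the countable intersection property
converges, hence the traces of points of `ϱ_ωG` make every continuous function converge. Conversely,
the trace of a point of `υG` has the countable intersection property and converges in each of these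
quotients, so it is two-sided Cauchy.

That it is also Cauchy for the fine uniformity is the delicate point, because the cardinality of
`G` may be measurable. For a continuous pseudometric, A. H. Stone's refinement of the cover by small
balls replaces the trace, up to a small error, by its image under a choice of centres. This image is
a countably complete ultrafilter, and two centres that are congruent, modulo suitable subgroups `N`,
to a third one have overlapping small neighbourhoods, so almost all centres are close together.
-/

namespace SMFactor

open Filter Set Topology Uniformity

section CountableIntersection

variable {X Y : Type*} {F : Filter X}

/-- The countable intersection property: any countably many members of `F` have a common point.
Unlike for `CountableInterFilter`, their intersection need not belong to `F`. -/
def HasCountableIntersections (F : Filter X) : Prop :=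
  ∀ S : Set (Set X), S.Countable → (∀ s ∈ S, s ∈ F) → (⋂₀ S).Nonempty

theorem HasCountableIntersections.exists_forall_mem (hF : HasCountableIntersections F)
    {ι : Sort*} [Countable ι] {s : ι → Set X} (hs : ∀ i, s i ∈ F) : ∃ x, ∀ i, x ∈ s i := by
  simpa [Set.Nonempty] using hF (range s) (countable_range s) (forall_mem_range.2 hs)

theorem HasCountableIntersections.mono (hF : HasCountableIntersections F) {F' : Filter X}
    (h : F ≤ F') : HasCountableIntersections F' :=
  fun S hS hSF => hF S hS fun s hs => h (hSF s hs)

theorem HasCountableIntersections.map (hF : HasCountableIntersections F) (f : X → Y) :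
    HasCountableIntersections (F.map f) := fun S hS hSF => by
  have := hS.to_subtype
  obtain ⟨x, hx⟩ := hF.exists_forall_mem fun s : S => hSF s s.2
  exact ⟨f x, fun s hs => hx ⟨s, hs⟩⟩

theorem HasCountableIntersections.countableInterFilter {𝒰 : Ultrafilter X}
    (h𝒰 : HasCountableIntersections (𝒰 : Filter X)) : CountableInterFilter (𝒰 : Filter X) where
  countable_sInter_mem S hS hS𝒰 := by
    by_contra h
    obtain ⟨_, hx⟩ := h𝒰 (insert (⋂₀ S)ᶜ S) (hS.insert _)
      (forall_mem_insert.2 ⟨Ultrafilter.compl_mem_iff_notMem.2 h, hS𝒰⟩)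
    exact hx _ (mem_insert _ _) fun s hs => hx s (mem_insert_of_mem _ hs)

theorem mem_gDeltaClosure_range_iff [TopologicalSpace Y] {e : X → Y} {y : Y} :
    y ∈ gDeltaClosure (range e) ↔ HasCountableIntersections (comap e (𝓝 y)) := by
  refine ⟨fun hy S hS hSF => ?_, fun hy s hs hys => ?_⟩
  · choose! W hW hWS using fun s hs => mem_comap.1 (hSF s hs)
    obtain ⟨_, hx, x, rfl⟩ := hy (⋂ s ∈ S, interior (W s))
      (.biInter_of_isOpen hS fun _ _ => isOpen_interior)
      (mem_iInter₂.2 fun s hs => mem_interior_iff_mem_nhds.2 (hW s hs))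
    exact ⟨x, fun s hs => hWS s hs (interior_subset (s := W s) (mem_iInter₂.1 hx s hs))⟩
  · obtain ⟨O, hO, rfl⟩ := isGδ_iff_eq_iInter_nat.1 hs
    obtain ⟨x, hx⟩ := hy.exists_forall_mem fun n =>
      preimage_mem_comap ((hO n).mem_nhds (mem_iInter.1 hys n))
    exact ⟨e x, mem_iInter.2 hx, mem_range_self x⟩

end CountableIntersection

section EvalFilter

variable {X : Type*} [TopologicalSpace X] {p : C(X, ℝ) → ℝ}

/-- The trace on `X` of the neighbourhood filter of the point `p` of `ℝ^C(X)`. -/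
def evalFilter (p : C(X, ℝ) → ℝ) : Filter X :=
  comap (evalMap X) (𝓝 p)

theorem tendsto_evalFilter (p : C(X, ℝ) → ℝ) (f : C(X, ℝ)) : Tendsto f (evalFilter p) (𝓝 (p f)) :=
  ((continuous_apply f).tendsto p).comp tendsto_comap

theorem evalFilter_neBot (hp : p ∈ closure (range (evalMap X))) : (evalFilter p).NeBot := by
  simpa [evalFilter, comap_neBot_iff_frequently, mem_closure_iff_frequently] using hp

/-- Otherwise `x ↦ (dist (Φ x) m)⁻¹` would be a continuous function unbounded along the filter. -/
theorem exists_apply_eq_of_tendsto_evalFilter {M : Type*} [TopologicalSpace M]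
    [TopologicalSpace.MetrizableSpace M] (hp : p ∈ closure (range (evalMap X))) {Φ : X → M}
    (hΦ : Continuous Φ) {m : M} (hm : Tendsto Φ (evalFilter p) (𝓝 m)) : ∃ x, Φ x = m := by
  have := evalFilter_neBot hp
  let _ := TopologicalSpace.metrizableSpaceMetric M
  by_contra! h
  have hpos : ∀ x, dist (Φ x) m ≠ 0 := fun x => dist_ne_zero.2 (h x)
  let f : C(X, ℝ) := ⟨fun x => (dist (Φ x) m)⁻¹, (hΦ.dist continuous_const).inv₀ hpos⟩
  have h0 : Tendsto (fun x => dist (Φ x) m * f x) (evalFilter p) (𝓝 (0 * p f)) :=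
    (tendsto_iff_dist_tendsto_zero.1 hm).mul (tendsto_evalFilter p f)
  have h1 : (fun x => dist (Φ x) m * f x) = fun _ => 1 :=
    funext fun x => mul_inv_cancel₀ (hpos x)
  rw [h1, zero_mul] at h0
  exact one_ne_zero (tendsto_nhds_unique tendsto_const_nhds h0)

theorem exists_forall_apply_eq (hp : p ∈ closure (range (evalMap X))) {ι : Type*} [Countable ι]
    (f : ι → C(X, ℝ)) : ∃ x, ∀ i, f i x = p (f i) := by
  obtain ⟨x, hx⟩ := exists_apply_eq_of_tendsto_evalFilter hp (Φ := fun x i => f i x)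
    (by fun_prop) (tendsto_pi_nhds.2 fun i => tendsto_evalFilter p (f i))
  exact ⟨x, congrFun hx⟩

theorem hasCountableIntersections_evalFilter (hp : p ∈ closure (range (evalMap X))) :
    HasCountableIntersections (evalFilter p) := fun S hS hSF => by
  have := hS.to_subtype
  choose W hW hWS using fun s : S => mem_comap.1 (hSF s s.2)
  simp only [nhds_pi, Filter.mem_pi] at hW
  choose I hI t ht hIt using hW
  have : Countable (⋃ s, I s) := (countable_iUnion fun s => (hI s).countable).to_subtype
  obtain ⟨x, hx⟩ := exists_forall_apply_eq hp fun f : ⋃ s, I s => (f : C(X, ℝ))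
  refine ⟨x, fun s hs => hWS ⟨s, hs⟩ (hIt _ fun f hf => ?_)⟩
  rw [evalMap, hx ⟨f, mem_iUnion_of_mem _ hf⟩]
  exact mem_of_mem_nhds (ht _ f)

theorem isInducing_evalMap (X : Type*) [TopologicalSpace X] [CompletelyRegularSpace X] :
    IsInducing (evalMap X) := by
  have hc : Continuous (evalMap X) := continuous_pi fun f => f.continuous
  refine isInducing_iff_nhds.2 fun x => le_antisymm (hc.tendsto x).le_comap fun V hV => ?_
  obtain ⟨f, hf, hfx, hfV⟩ := CompletelyRegularSpace.completely_regular_isOpen x (interior V)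
    isOpen_interior (mem_interior_iff_mem_nhds.2 hV)
  have ht := tendsto_evalFilter (evalMap X x) ⟨fun y => (f y : ℝ), by fun_prop⟩
  refine mem_of_superset (ht.eventually (gt_mem_nhds (?_ : _ < (1 : ℝ)))) fun y hy => ?_
  · simp [evalMap, hfx]
  · by_contra hyV
    have hfy : f y = 1 := hfV fun h => hyV (interior_subset h)
    simp [hfy] at hy

end EvalFilter

section SeparablySubmetrizable

variable {X Y : Type*} [TopologicalSpace X] [TopologicalSpace Y]

/-- The topology of `Y` is finer than a separable metrizable one. Since every separable metrizable
space embeds in `ℝ^ℕ`, the coarser topology is encoded by a continuous injection into `ℝ^ℕ`. -/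
def SeparablySubmetrizable (Y : Type*) [TopologicalSpace Y] : Prop :=
  ∃ Φ : Y → ℕ → ℝ, Continuous Φ ∧ Function.Injective Φ

theorem separablySubmetrizable_of_injective {M : Type*} [TopologicalSpace M]
    [SecondCountableTopology M] [T3Space M] {g : Y → M} (hg : Continuous g)
    (hinj : Function.Injective g) : SeparablySubmetrizable Y := by
  obtain ⟨e, he⟩ := TopologicalSpace.exists_embedding_l_infty M
  refine ⟨fun y n => e (g y) n, ?_, fun y z h => hinj (he.injective (DFunLike.coe_injective h))⟩
  exact continuous_pi fun n => (continuous_eval_const n).comp (he.continuous.comp hg)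

theorem SeparablySubmetrizable.isGδ_singleton (hY : SeparablySubmetrizable Y) (y : Y) :
    IsGδ {y} := by
  obtain ⟨Φ, hΦ, hinj⟩ := hY
  have h : Φ ⁻¹' {Φ y} = {y} := by ext z; simp [hinj.eq_iff]
  exact h ▸ (IsGδ.singleton _).preimage hΦ

theorem SeparablySubmetrizable.exists_tendsto_evalFilter [CompletelyRegularSpace Y]
    (hY : SeparablySubmetrizable Y) {p : C(X, ℝ) → ℝ} (hp : p ∈ closure (range (evalMap X)))
    {q : X → Y} (hq : Continuous q) : ∃ x, Tendsto q (evalFilter p) (𝓝 (q x)) := by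
  obtain ⟨Φ, hΦ, hinj⟩ := hY
  let c : ℕ → C(X, ℝ) := fun n => ⟨fun x => Φ (q x) n, by fun_prop⟩
  obtain ⟨x, hx⟩ := exists_forall_apply_eq hp c
  refine ⟨x, (isInducing_evalMap Y).tendsto_nhds_iff.2 (tendsto_pi_nhds.2 fun f => ?_)⟩
  obtain ⟨x', hx'⟩ := exists_forall_apply_eq hp fun n : Option ℕ => n.elim (f.comp ⟨q, hq⟩) c
  have hqx : q x' = q x := hinj (funext fun n => (hx' (some n)).trans (hx n).symm)
  have hpf : p (f.comp ⟨q, hq⟩) = f (q x) := (hx' none).symm.trans (congrArg f hqx)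
  have hf := tendsto_evalFilter p (f.comp ⟨q, hq⟩)
  rwa [hpf] at hf

end SeparablySubmetrizable

section Factorization

variable {G : Type*} [Group G] [TopologicalSpace G]

theorem IsSimplySMFactorizable.exists_factorization [IsTopologicalGroup G]
    (hG : IsSimplySMFactorizable G) {f : G → ℝ} (hf : Continuous f) :
    ∃ (N : Subgroup G) (_ : N.Normal), SeparablySubmetrizable (G ⧸ N) ∧
      ∃ f' : G ⧸ N → ℝ, Continuous f' ∧ ∀ x : G, f' x = f x := by
  have hU : ∀ q : ℚ, IsCozero {x | (q : ℝ) < f x} := fun q =>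
    ⟨fun x => max (f x - q) 0, by fun_prop, by ext x; simp⟩
  choose H _ _ π _ _ _ hπ _ hπU using fun q => hG _ (hU q)
  have (q : ℚ) : SecondCountableTopology (H q) := by
    let _ := TopologicalSpace.metrizableSpaceMetric (H q)
    exact UniformSpace.secondCountable_of_separable (H q)
  have hle : ∀ a b, MonoidHom.pi π a = MonoidHom.pi π b → f a ≤ f b := fun a b hab =>
    le_of_forall_rat_lt_imp_le fun q hq => by
      have hb : b ∈ π q ⁻¹' (π q '' {x | (q : ℝ) < f x}) := ⟨a, hq, congrFun hab q⟩
      rw [hπU] at hb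
      exact hb.le
  refine ⟨(MonoidHom.pi π).ker, inferInstance,
    separablySubmetrizable_of_injective (g := QuotientGroup.kerLift (MonoidHom.pi π))
      (continuous_quot_lift _ (continuous_pi hπ)) (QuotientGroup.kerLift_injective _),
    Quotient.lift f fun a b hab => ?_, hf.quotient_lift _, fun x => rfl⟩
  have hab : MonoidHom.pi π a = MonoidHom.pi π b :=
    congrArg (QuotientGroup.kerLift (MonoidHom.pi π)) (Quotient.sound hab)
  exact le_antisymm (hle a b hab) (hle b a hab.symm)

theorem completelyRegularSpace_of_isTopologicalGroup (G : Type*) [Group G] [TopologicalSpace G]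
    [IsTopologicalGroup G] : CompletelyRegularSpace G :=
  .of_exists_uniformSpace ⟨IsTopologicalGroup.leftUniformSpace G, rfl⟩

theorem IsSimplySMFactorizable.exists_quotient_preimage_subset [IsTopologicalGroup G]
    (hG : IsSimplySMFactorizable G) {V : Set G} (hV : V ∈ 𝓝 1) :
    ∃ (N : Subgroup G) (_ : N.Normal), SeparablySubmetrizable (G ⧸ N) ∧
      ∃ O ∈ 𝓝 (1 : G ⧸ N), ((↑) : G → G ⧸ N) ⁻¹' O ⊆ V := by
  have := completelyRegularSpace_of_isTopologicalGroup G
  obtain ⟨f, hf, hf1, hfV⟩ := CompletelyRegularSpace.completely_regular_isOpen 1 (interior V)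
    isOpen_interior (mem_interior_iff_mem_nhds.2 hV)
  obtain ⟨N, hN, hQ, f', hf', hff'⟩ := hG.exists_factorization (f := fun x => (f x : ℝ))
    (by fun_prop)
  refine ⟨N, hN, hQ, {y | f' y < 1}, hf'.continuousAt.eventually (gt_mem_nhds ?_), fun x hx => ?_⟩
  · simp [← QuotientGroup.mk_one, hff', hf1]
  · by_contra hxV
    have hfx : f x = 1 := hfV fun h => hxV (interior_subset h)
    simp [hff', hfx] at hx

end Factorization

section CauchyFilters

variable {G : Type*} [Group G] [TopologicalSpace G] [IsTopologicalGroup G] {F : Filter G}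

theorem cauchy_twoSided_iff :
    Cauchy (uniformSpace := twoSidedUniformSpace G) F ↔
      F.NeBot ∧ Tendsto (fun x : G × G => x.1⁻¹ * x.2) (F ×ˢ F) (𝓝 1) ∧
        Tendsto (fun x : G × G => x.2 * x.1⁻¹) (F ×ˢ F) (𝓝 1) := by
  rw [cauchy_inf_uniformSpace, tendsto_iff_comap, tendsto_iff_comap, and_and_left]
  rfl

theorem HasCountableIntersections.exists_le_nhds (hF : HasCountableIntersections F)
    (h1 : IsGδ {(1 : G)}) (hc : Tendsto (fun x : G × G => x.1⁻¹ * x.2) (F ×ˢ F) (𝓝 1)) :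
    ∃ g, F ≤ 𝓝 g := by
  obtain ⟨O, hO, hO1⟩ := isGδ_iff_eq_iInter_nat.1 h1
  have hsmall : ∀ V ∈ 𝓝 (1 : G), ∃ A ∈ F, ∀ a ∈ A, ∀ b ∈ A, a⁻¹ * b ∈ V := fun V hV => by
    obtain ⟨A, hA, h⟩ := mem_prod_same_iff.1 (hc hV)
    exact ⟨A, hA, fun a ha b hb => h (mk_mem_prod ha hb)⟩
  choose A hA hAO using fun n => hsmall (O n)
    ((hO n).mem_nhds (mem_iInter.1 (hO1 ▸ mem_singleton (1 : G)) n))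
  obtain ⟨g, hg⟩ := hF.exists_forall_mem hA
  have hgB : ∀ B ∈ F, g ∈ B := fun B hB => by
    obtain ⟨g', hg'⟩ := hF.exists_forall_mem fun n => inter_mem hB (hA n)
    have hgg' : g⁻¹ * g' ∈ ({1} : Set G) :=
      hO1 ▸ mem_iInter.2 fun n => hAO n g (hg n) g' (hg' n).2
    exact inv_mul_eq_one.1 hgg' ▸ (hg' 0).1
  refine ⟨g, fun V hV => ?_⟩
  have hgV : (g * ·) ⁻¹' V ∈ 𝓝 (1 : G) :=
    (continuous_const_mul g).continuousAt.preimage_mem_nhds (by simpa using hV)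
  obtain ⟨B, hB, hBV⟩ := hsmall _ hgV
  exact mem_of_superset hB fun b hb => by simpa using hBV g (hgB B hB) b hb

theorem IsSimplySMFactorizable.exists_tendsto_of_cauchy (hG : IsSimplySMFactorizable G)
    (hF : HasCountableIntersections F)
    (hc : Cauchy (uniformSpace := twoSidedUniformSpace G) F) {f : G → ℝ} (hf : Continuous f) :
    ∃ c, Tendsto f F (𝓝 c) := by
  obtain ⟨N, _, hQ, f', hf', hff'⟩ := hG.exists_factorization hf
  have hmk : Tendsto (fun x : G × G => ((x.1⁻¹ * x.2 : G) : G ⧸ N)) (F ×ˢ F) (𝓝 1) :=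
    (QuotientGroup.continuous_mk.tendsto' 1 1 rfl).comp (cauchy_twoSided_iff.1 hc).2.1
  obtain ⟨y, hy⟩ := (hF.map ((↑) : G → G ⧸ N)).exists_le_nhds (hQ.isGδ_singleton 1)
    (by rw [prod_map_map_eq]; exact tendsto_map'_iff.2 hmk)
  exact ⟨f' y, ((hf'.tendsto y).comp hy).congr hff'⟩

theorem IsSimplySMFactorizable.cauchy_twoSided_evalFilter (hG : IsSimplySMFactorizable G)
    {p : C(G, ℝ) → ℝ} (hp : p ∈ closure (range (evalMap G))) :
    Cauchy (uniformSpace := twoSidedUniformSpace G) (evalFilter p) := by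
  have hlift : ∀ w : G × G → G,
      (∀ (N : Subgroup G) [N.Normal] (g : G), Tendsto (↑) (evalFilter p) (𝓝 (g : G ⧸ N)) →
        Tendsto (fun x => (w x : G ⧸ N)) (evalFilter p ×ˢ evalFilter p) (𝓝 1)) →
      Tendsto w (evalFilter p ×ˢ evalFilter p) (𝓝 1) := fun w hw V hV => by
    obtain ⟨N, _, hQ, O, hO, hOV⟩ := hG.exists_quotient_preimage_subset hV
    have := completelyRegularSpace_of_isTopologicalGroup (G ⧸ N)
    obtain ⟨g, hg⟩ := hQ.exists_tendsto_evalFilter hp QuotientGroup.continuous_mk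
    exact mem_of_superset (hw N g hg hO) fun x hx => hOV hx
  refine cauchy_twoSided_iff.2 ⟨evalFilter_neBot hp, hlift _ fun N _ g hg => ?_,
    hlift _ fun N _ g hg => ?_⟩
  · simpa using (hg.comp tendsto_fst).inv.mul (hg.comp tendsto_snd)
  · simpa using (hg.comp tendsto_snd).mul (hg.comp tendsto_fst).inv

end CauchyFilters

section CountablyCompleteUltrafilter

variable {G : Type*} [Group G] [TopologicalSpace G] [IsTopologicalGroup G]

theorem exists_eventually_eq_of_countableInterFilter {X Y : Type*} [TopologicalSpace Y]
    [SecondCountableTopology Y] [T0Space Y] [Nonempty Y] (𝒰 : Ultrafilter X)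
    [CountableInterFilter (𝒰 : Filter X)] (f : X → Y) : ∃ y, ∀ᶠ x in 𝒰, f x = y :=
  exists_eventuallyEq_const_of_forall_separating IsOpen fun U _ => 𝒰.em fun x => f x ∈ U

theorem IsSimplySMFactorizable.exists_subgroup_mul_mem (hG : IsSimplySMFactorizable G) {x : G}
    {U : Set G} (hU : U ∈ 𝓝 x) :
    ∃ (N : Subgroup G) (_ : N.Normal), SeparablySubmetrizable (G ⧸ N) ∧ ∀ n ∈ N, x * n ∈ U := by
  have hxU : (x * ·) ⁻¹' U ∈ 𝓝 (1 : G) :=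
    (continuous_const_mul x).continuousAt.preimage_mem_nhds (by simpa using hU)
  obtain ⟨N, hN, hQ, O, hO, hOU⟩ := hG.exists_quotient_preimage_subset hxU
  refine ⟨N, hN, hQ, fun n hn => hOU ?_⟩
  rw [mem_preimage, (QuotientGroup.eq_one_iff n).2 hn]
  exact mem_of_mem_nhds hO

/-- For a suitable third point `k`, the neighbourhoods `U x` and `U y` share the point
`x * k⁻¹ * y`: with normal subgroups `N x` such that `x * N x ⊆ U x`, the points `k` and `y` are
congruent modulo `N x`, and `x` and `k` are congruent modulo `N y`. -/
theorem IsSimplySMFactorizable.eventually_eventually_inter_nonempty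
    (hG : IsSimplySMFactorizable G) (𝒰 : Ultrafilter G) [CountableInterFilter (𝒰 : Filter G)]
    {U : G → Set G} (hU : ∀ x, U x ∈ 𝓝 x) : ∀ᶠ x in 𝒰, ∀ᶠ y in 𝒰, (U x ∩ U y).Nonempty := by
  choose N hN hQ hNU using fun x => hG.exists_subgroup_mul_mem (hU x)
  choose Φ _ hinj using hQ
  let c : G → G → ℕ → ℝ := fun x a => Φ x a
  have hc : ∀ {x a b}, c x a = c x b → a⁻¹ * b ∈ N x := fun h => QuotientGroup.eq.1 (hinj _ h)
  choose r hr using fun x => exists_eventually_eq_of_countableInterFilter 𝒰 (c x)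
  choose s hs using fun a => exists_eventually_eq_of_countableInterFilter 𝒰 fun x => c x a
  obtain ⟨q, hq⟩ := exists_eventually_eq_of_countableInterFilter 𝒰 s
  filter_upwards [hq] with x hx
  obtain ⟨k, hkx, hk⟩ := ((hr x).and hq).exists
  filter_upwards [hr x, hs x, hs k] with y hxy hyx hyk
  have hxN : k⁻¹ * y ∈ N x := hc (hkx.trans hxy.symm)
  have hyN : k⁻¹ * x ∈ N y := hc ((hyk.trans hk).trans (hyx.trans hx).symm)
  refine ⟨x * (k⁻¹ * y), hNU x _ hxN, ?_⟩
  have hconj : y⁻¹ * (x * k⁻¹) * y ∈ N y := by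
    simpa using (hN y).conj_mem _ ((hN y).mem_comm hyN) y⁻¹
  simpa [mul_assoc] using hNU y _ hconj

theorem IsSimplySMFactorizable.exists_eventually_dist_lt_of_ultrafilter {M : Type*}
    [PseudoMetricSpace M] (hG : IsSimplySMFactorizable G) (𝒰 : Ultrafilter G)
    [CountableInterFilter (𝒰 : Filter G)] {φ : G → M} (hφ : Continuous φ) {ε : ℝ} (hε : 0 < ε) :
    ∃ x, ∀ᶠ y in 𝒰, dist (φ y) (φ x) < ε := by
  obtain ⟨x, hx⟩ := (hG.eventually_eventually_inter_nonempty 𝒰 fun x =>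
    hφ.continuousAt.preimage_mem_nhds (Metric.ball_mem_nhds (φ x) (half_pos hε))).exists
  refine ⟨x, hx.mono fun y ⟨z, hzx, hzy⟩ => ?_⟩
  have hzx : dist (φ z) (φ x) < ε / 2 := hzx
  have hzy : dist (φ z) (φ y) < ε / 2 := hzy
  linarith [dist_triangle_left (φ y) (φ x) (φ z)]

end CountablyCompleteUltrafilter

section Pseudometric

variable {X : Type*}

theorem exists_seq_symm_comp_subset [UniformSpace X] {V : SetRel X X} (hV : V ∈ 𝓤 X) :
    ∃ W : ℕ → SetRel X X, (∀ n, W n ∈ 𝓤 X) ∧ (∀ n, (W n).IsSymm) ∧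
      (∀ n, (W (n + 1)).comp (W (n + 1)) ⊆ W n) ∧ W 0 ⊆ V := by
  choose next hnext using fun W : {W : SetRel X X // W ∈ 𝓤 X} => comp_symm_mem_uniformity_sets W.2
  let W : ℕ → {W : SetRel X X // W ∈ 𝓤 X} :=
    Nat.rec ⟨next ⟨V, hV⟩, (hnext ⟨V, hV⟩).1⟩ fun _ W => ⟨next W, (hnext W).1⟩
  refine ⟨fun n => (W n).1, fun n => (W n).2, fun n => ?_, fun n => ?_, ?_⟩
  · cases n with
    | zero => exact (hnext ⟨V, hV⟩).2.1
    | succ n => exact (hnext (W n)).2.1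
  · exact (hnext (W n)).2.2
  · exact (subset_comp_self_of_mem_uniformity (W 0).2).trans (hnext ⟨V, hV⟩).2.2

theorem exists_isCountablyGenerated_uniformity [u : UniformSpace X] {V : SetRel X X}
    (hV : V ∈ 𝓤 X) :
    ∃ u' : UniformSpace X, u ≤ u' ∧ 𝓤[u'].IsCountablyGenerated ∧ V ∈ 𝓤[u'] := by
  obtain ⟨W, hW, hsymm, hcomp, hWV⟩ := exists_seq_symm_comp_subset hV
  have hanti : Antitone W := antitone_nat_of_succ_le fun n =>
    (subset_comp_self_of_mem_uniformity (hW (n + 1))).trans (hcomp n)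
  have hb : (⨅ n, 𝓟 (W n)).HasBasis (fun _ => True) W :=
    hasBasis_iInf_principal hanti.directed_ge
  let u' : UniformSpace X := .ofCore
    { uniformity := ⨅ n, 𝓟 (W n)
      refl := le_iInf fun n => refl_le_uniformity.trans (le_principal_iff.2 (hW n))
      symm := (hb.tendsto_iff hb).2 fun n _ => ⟨n, trivial, fun _ hx => (hsymm n).symm _ _ hx⟩
      comp := ((hb.lift' (monotone_id.relComp monotone_id)).le_basis_iff hb).2 fun n _ =>
        ⟨n + 1, trivial, hcomp n⟩ }
  refine ⟨u', ?_, ?_, mem_of_superset (hb.mem_of_mem (i := 0) trivial) hWV⟩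
  · exact le_iInf fun n => le_principal_iff.2 (hW n)
  · exact (inferInstance : (⨅ n, 𝓟 (W n)).IsCountablyGenerated)

theorem exists_pseudoMetricSpace_of_mem_uniformity [u : UniformSpace X] {V : SetRel X X}
    (hV : V ∈ 𝓤 X) :
    ∃ m : PseudoMetricSpace X, u ≤ m.toUniformSpace ∧
      ∃ ε > 0, ∀ x y, m.dist x y < ε → (x, y) ∈ V := by
  obtain ⟨u', hu, _, hV'⟩ := exists_isCountablyGenerated_uniformity hV
  obtain ⟨m, rfl⟩ := @UniformSpace.metrizable_uniformity X u' _
  obtain ⟨ε, hε, h⟩ := Metric.mem_uniformity_dist.1 hV'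
  exact ⟨m, hu, ε, hε, fun x y => @h x y⟩

/-- A. H. Stone's construction: `T n i` consists of the points that lie deep inside the ball around
`c i` but outside all earlier balls in a well-ordering of the centres. -/
theorem exists_sigma_discrete_refinement {ι M : Type*} [PseudoMetricSpace M] (c : ι → M) (ε : ℝ) :
    ∃ T : ℕ → ι → Set M, (∀ x i, dist x (c i) < ε → ∃ n j, x ∈ T n j) ∧
      (∀ n i j, ∀ x ∈ T n i, ∀ y ∈ T n j, dist x y < 1 / (n + 1 : ℝ) → i = j) ∧
      ∀ n i, ∀ x ∈ T n i, dist x (c i) ≤ ε - 1 / (n + 1 : ℝ) := by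
  let r : ι → ι → Prop := WellOrderingRel
  refine ⟨fun n i => {x | dist x (c i) ≤ ε - 1 / (n + 1 : ℝ) ∧ ∀ j, r j i → ε ≤ dist x (c j)},
    fun x i hi => ?_, fun n i j x hx y hy hxy => ?_, fun n i x hx => hx.1⟩
  · have hwf : WellFounded r := WellOrderingRel.isWellOrder.wf
    obtain ⟨j, hj, hmin⟩ := hwf.has_min {j | dist x (c j) < ε} ⟨i, hi⟩
    obtain ⟨n, hn⟩ := exists_nat_one_div_lt (K := ℝ) (sub_pos.2 hj)
    exact ⟨n, j, by linarith, fun k hk => not_lt.1 fun h => hmin k h hk⟩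
  · have hsep : ∀ {i j x y}, dist x (c i) ≤ ε - 1 / (n + 1 : ℝ) →
        (∀ k, r k j → ε ≤ dist y (c k)) → dist x y < 1 / (n + 1 : ℝ) → ¬r i j :=
      fun {i j x y} hx hy hxy hij => by linarith [hy i hij, dist_triangle_left y (c i) x]
    rcases trichotomous_of r i j with h | h | h
    · exact (hsep hx.1 hy.2 hxy h).elim
    · exact h
    · exact (hsep hy.1 hx.2 (dist_comm x y ▸ hxy) h).elim

end Pseudometric

section EvalFilterPseudometric

variable {X M : Type*} [TopologicalSpace X] [PseudoMetricSpace M] {p : C(X, ℝ) → ℝ} {φ : X → M}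

theorem eventually_evalFilter_mem_thickening_or_notMem (p : C(X, ℝ) → ℝ) (hφ : Continuous φ)
    (A : Set M) {δ : ℝ} (hδ : 0 < δ) :
    (∀ᶠ x in evalFilter p, φ x ∈ Metric.thickening δ A) ∨ ∀ᶠ x in evalFilter p, φ x ∉ A := by
  let f : C(X, ℝ) := ⟨fun x => thickenedIndicator hδ A (φ x), by fun_prop⟩
  have hf := tendsto_evalFilter p f
  by_cases h0 : p f = 0
  · refine .inr ((hf.eventually_ne (h0 ▸ zero_ne_one)).mono fun x hx hxA => hx ?_)
    exact congrArg NNReal.toReal (thickenedIndicator_one hδ A hxA)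
  · refine .inl ((hf.eventually_ne h0).mono fun x hx => not_not.1 fun hxA => hx ?_)
    exact congrArg NNReal.toReal (thickenedIndicator_zero hδ A hxA)

theorem exists_eventually_evalFilter_mem_thickening (hp : p ∈ closure (range (evalMap X)))
    (hφ : Continuous φ) {A : ℕ → Set M} (hA : ∀ x, ∃ n, φ x ∈ A n) {δ : ℕ → ℝ}
    (hδ : ∀ n, 0 < δ n) : ∃ n, ∀ᶠ x in evalFilter p, φ x ∈ Metric.thickening (δ n) (A n) := by
  by_contra h
  obtain ⟨x, hx⟩ := (hasCountableIntersections_evalFilter hp).exists_forall_mem fun n =>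
    (eventually_evalFilter_mem_thickening_or_notMem p hφ (A n) (hδ n)).resolve_left
      (not_exists.1 h n)
  obtain ⟨n, hn⟩ := hA x
  exact hx n hn

/-- Every union of a subfamily of a uniformly discrete family is separated from the union of the
rest by a continuous function. -/
theorem exists_ultrafilter_eq_map_evalFilter (hp : p ∈ closure (range (evalMap X)))
    (hφ : Continuous φ) {ι : Type*} {T : ι → Set M} {δ : ℝ} (hδ : 0 < δ)
    (hsep : ∀ i j, ∀ x ∈ T i, ∀ y ∈ T j, dist x y < δ → i = j) {c : X → ι}
    (hc : ∀ᶠ x in evalFilter p, φ x ∈ Metric.thickening (δ / 4) (T (c x))) :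
    ∃ 𝒰 : Ultrafilter ι, (𝒰 : Filter ι) = (evalFilter p).map c := by
  have := evalFilter_neBot hp
  refine ⟨.ofComplNotMemIff ((evalFilter p).map c) fun S => ⟨fun hS => ?_, compl_notMem⟩, rfl⟩
  rcases eventually_evalFilter_mem_thickening_or_notMem p hφ
    (⋃ i ∈ S, Metric.thickening (δ / 4) (T i)) (half_pos hδ) with h | h
  · rw [mem_map]
    filter_upwards [h, hc] with x hx hcx
    obtain ⟨z, hz, hxz⟩ := Metric.mem_thickening_iff.1 hx
    obtain ⟨i, hi, hzi⟩ := mem_iUnion₂.1 hz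
    obtain ⟨a, ha, hza⟩ := Metric.mem_thickening_iff.1 hzi
    obtain ⟨b, hb, hxb⟩ := Metric.mem_thickening_iff.1 hcx
    have hab : dist a b < δ := by
      linarith [dist_triangle4 a z (φ x) b, dist_comm a z, dist_comm z (φ x)]
    exact mem_preimage.2 (hsep i (c x) a ha b hb hab ▸ hi)
  · refine (hS (mem_map.2 ?_)).elim
    filter_upwards [h, hc] with x hx hcx hcS
    exact hx (mem_biUnion hcS hcx)

theorem exists_ultrafilter_eq_map_evalFilter_dist_lt (hp : p ∈ closure (range (evalMap X)))
    (hφ : Continuous φ) {ε : ℝ} (hε : 0 < ε) :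
    ∃ (c : X → X) (𝒰 : Ultrafilter X), (𝒰 : Filter X) = (evalFilter p).map c ∧
      ∀ᶠ x in evalFilter p, dist (φ x) (φ (c x)) < ε := by
  obtain ⟨T, hcover, hsep, hsmall⟩ := exists_sigma_discrete_refinement φ ε
  have hpos (n : ℕ) : (0 : ℝ) < 1 / (n + 1) := by positivity
  obtain ⟨n, hn⟩ := exists_eventually_evalFilter_mem_thickening hp hφ (A := fun n => ⋃ i, T n i)
    (fun x => by simpa using hcover (φ x) x (by simpa using hε)) fun n =>
      div_pos (hpos n) four_pos
  have := evalFilter_neBot hp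
  have := nonempty_of_neBot (evalFilter p)
  simp only [Metric.thickening_iUnion, mem_iUnion] at hn
  obtain ⟨c, hc⟩ := hn.choice
  obtain ⟨𝒰, h𝒰⟩ := exists_ultrafilter_eq_map_evalFilter hp hφ (hpos n) (hsep n) hc
  refine ⟨c, 𝒰, h𝒰, hc.mono fun x hx => ?_⟩
  obtain ⟨z, hz, hxz⟩ := Metric.mem_thickening_iff.1 hx
  linarith [hsmall n (c x) z hz, dist_triangle (φ x) z (φ (c x)), hpos n]

end EvalFilterPseudometric

section FineUniformity

variable {X : Type*} [TopologicalSpace X] [CompletelyRegularSpace X]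

theorem uniformContinuous_fine {f : X → ℝ} (hf : Continuous f) :
    @UniformContinuous X ℝ (fineUniformSpace X) _ f := by
  have hle : fineUniformSpace X ≤ fineUniformSpace X ⊓ UniformSpace.comap f inferInstance := by
    refine sInf_le ?_
    rw [mem_ofPred_eq, UniformSpace.toTopologicalSpace_inf, fineUniformSpace_toTopologicalSpace]
    exact inf_eq_left.2 hf.le_induced
  exact uniformContinuous_iff_le_comap.2 (hle.trans inf_le_right)

theorem exists_tendsto_of_cauchy_fine {F : Filter X}
    (hF : Cauchy (uniformSpace := fineUniformSpace X) F) {f : X → ℝ} (hf : Continuous f) :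
    ∃ c, Tendsto f F (𝓝 c) :=
  CompleteSpace.complete (@Cauchy.map X ℝ (fineUniformSpace X) _ F f hF (uniformContinuous_fine hf))

theorem continuous_id_of_fineUniformSpace_le {m : UniformSpace X} (hm : fineUniformSpace X ≤ m) :
    @Continuous X X _ m.toTopologicalSpace id := by
  have h := UniformSpace.toTopologicalSpace_mono hm
  rw [fineUniformSpace_toTopologicalSpace] at h
  exact continuous_id_iff_le.2 h

variable {G : Type*} [Group G] [TopologicalSpace G] [IsTopologicalGroup G] {p : C(G, ℝ) → ℝ}

theorem IsSimplySMFactorizable.exists_eventually_dist_lt {M : Type*} [PseudoMetricSpace M]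
    (hG : IsSimplySMFactorizable G) (hp : p ∈ closure (range (evalMap G))) {φ : G → M}
    (hφ : Continuous φ) {ε : ℝ} (hε : 0 < ε) :
    ∃ x, ∀ᶠ y in evalFilter p, dist (φ y) (φ x) < ε := by
  obtain ⟨c, 𝒰, h𝒰, hc⟩ := exists_ultrafilter_eq_map_evalFilter_dist_lt hp hφ (half_pos hε)
  have hcount : HasCountableIntersections (𝒰 : Filter G) :=
    h𝒰 ▸ (hasCountableIntersections_evalFilter hp).map c
  have := hcount.countableInterFilter
  obtain ⟨x, hx⟩ := hG.exists_eventually_dist_lt_of_ultrafilter 𝒰 hφ (half_pos hε)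
  rw [h𝒰, eventually_map] at hx
  refine ⟨x, (hc.and hx).mono fun y hy => ?_⟩
  linarith [hy.1, hy.2, dist_triangle (φ y) (φ (c y)) (φ x)]

theorem IsSimplySMFactorizable.cauchy_fine_evalFilter (hG : IsSimplySMFactorizable G)
    (hp : p ∈ closure (range (evalMap G))) :
    Cauchy (uniformSpace := fineUniformSpace G) (evalFilter p) := by
  have := completelyRegularSpace_of_isTopologicalGroup G
  refine ⟨evalFilter_neBot hp, fun V hV => ?_⟩
  obtain ⟨m, hm, ε, hε, hV⟩ :=
    @exists_pseudoMetricSpace_of_mem_uniformity G (fineUniformSpace G) V hV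
  obtain ⟨x, hx⟩ := hG.exists_eventually_dist_lt hp (continuous_id_of_fineUniformSpace_le hm)
    (half_pos hε)
  refine mem_of_superset (prod_mem_prod hx hx) fun ⟨y, z⟩ ⟨hy, hz⟩ => hV y z ?_
  have hy : dist y x < ε / 2 := hy
  have hz : dist z x < ε / 2 := hz
  linarith [dist_triangle_right y z x]

end FineUniformity

section DenseInducing

variable {X Y Z : Type*} [TopologicalSpace Y] [TopologicalSpace Z]

theorem comap_codRestrict_nhds {e : X → Y} {A : Set Y} (hA : ∀ x, e x ∈ A) (y : A) :
    comap (A.codRestrict e hA) (𝓝 y) = comap e (𝓝 y) := by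
  rw [nhds_subtype, comap_comap]
  rfl

variable [TopologicalSpace X]

theorem isDenseInducing_codRestrict {e : X → Y} (he : IsInducing e) {A : Set Y}
    (hA : ∀ x, e x ∈ A) (hd : A ⊆ closure (range e)) :
    IsDenseInducing (A.codRestrict e hA) where
  toIsInducing := he.codRestrict hA
  dense y := by
    rw [IsInducing.subtypeVal.closure_eq_preimage_closure_image, ← range_comp]
    exact hd y.2

theorem exists_homeomorph_of_isDenseInducing [T3Space Y] [T3Space Z] {i : X → Y} {j : X → Z}
    (hi : IsDenseInducing i) (hj : IsDenseInducing j)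
    (hij : ∀ y, ∃ z, Tendsto j (comap i (𝓝 y)) (𝓝 z))
    (hji : ∀ z, ∃ y, Tendsto i (comap j (𝓝 z)) (𝓝 y)) :
    ∃ h : Y ≃ₜ Z, ∀ x, h (i x) = j x := by
  have hc := hi.continuous_extend hij
  have hc' := hj.continuous_extend hji
  have h₁ : ∀ x, hi.extend j (i x) = j x := hi.extend_eq hj.continuous
  have h₂ : ∀ x, hj.extend i (j x) = i x := hj.extend_eq hi.continuous
  refine ⟨⟨⟨hi.extend j, hj.extend i, fun y => ?_, fun z => ?_⟩, hc, hc'⟩, h₁⟩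
  · exact congrFun (hi.dense.equalizer (hc'.comp hc) continuous_id
      (funext fun x => by simp [h₁, h₂])) y
  · exact congrFun (hj.dense.equalizer (hc.comp hc') continuous_id
      (funext fun x => by simp [h₁, h₂])) z

end DenseInducing

section Realcompactification

variable {X : Type*} [TopologicalSpace X]

theorem isDenseInducing_toRealcompactification (X : Type*) [TopologicalSpace X]
    [CompletelyRegularSpace X] : IsDenseInducing (toRealcompactification X) :=
  isDenseInducing_codRestrict (isInducing_evalMap X) _ subset_rfl

theorem comap_toRealcompactification_nhds (y : Realcompactification X) :
    comap (toRealcompactification X) (𝓝 y) = evalFilter y.1 :=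
  comap_codRestrict_nhds _ y

theorem exists_tendsto_toRealcompactification {ι : Type*} {F : Filter ι} [F.NeBot] {u : ι → X}
    (hF : ∀ f : X → ℝ, Continuous f → ∃ c, Tendsto (fun i => f (u i)) F (𝓝 c)) :
    ∃ y, Tendsto (fun i => toRealcompactification X (u i)) F (𝓝 y) := by
  choose p hp using fun f : C(X, ℝ) => hF f f.continuous
  have ht : Tendsto (fun i => evalMap X (u i)) F (𝓝 p) := tendsto_pi_nhds.2 hp
  exact ⟨⟨p, mem_closure_of_tendsto ht (.of_forall fun i => mem_range_self (u i))⟩,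
    tendsto_subtype_rng.2 ht⟩

theorem exists_continuous_extension_realcompactification {Y : Type*} [TopologicalSpace Y]
    [CompletelyRegularSpace X] {u : X → Y} (hu : Continuous u) :
    ∃ j : Realcompactification X → Realcompactification Y, Continuous j ∧
      ∀ x, j (toRealcompactification X x) = toRealcompactification Y (u x) := by
  have hd := isDenseInducing_toRealcompactification X
  have hj : Continuous fun x => toRealcompactification Y (u x) :=
    Continuous.subtype_mk (continuous_pi fun f => f.continuous.comp hu) _
  refine ⟨hd.extend fun x => toRealcompactification Y (u x), hd.continuous_extend fun y => ?_,
    hd.extend_eq hj⟩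
  have := hd.comap_nhds_neBot y
  rw [comap_toRealcompactification_nhds] at this ⊢
  exact exists_tendsto_toRealcompactification fun f hf =>
    ⟨_, tendsto_evalFilter y.1 ⟨fun x => f (u x), by fun_prop⟩⟩

end Realcompactification

section Completion

theorem exists_tendsto_completion_coe {X : Type*} [UniformSpace X] {F : Filter X} (hF : Cauchy F) :
    ∃ z : UniformSpace.Completion X, Tendsto ((↑) : X → UniformSpace.Completion X) F (𝓝 z) :=
  CompleteSpace.complete (hF.map (UniformSpace.Completion.uniformContinuous_coe X))

theorem cauchy_comap_completion_coe {X : Type*} [UniformSpace X] (z : UniformSpace.Completion X) :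
    Cauchy (comap ((↑) : X → UniformSpace.Completion X) (𝓝 z)) := by
  have := UniformSpace.Completion.isDenseInducing_coe.comap_nhds_neBot z
  exact cauchy_nhds.comap (UniformSpace.Completion.comap_coe_eq_uniformity X).le

theorem isDenseInducing_completion_coe {X : Type*} [t : TopologicalSpace X] (v : UniformSpace X)
    (h : v.toTopologicalSpace = t) : IsDenseInducing (@UniformSpace.Completion.coe' X v) := by
  subst h
  exact UniformSpace.Completion.isDenseInducing_coe

instance (X : Type*) [TopologicalSpace X] : T0Space (DieudonneCompletion X) :=
  @UniformSpace.Completion.t0Space X (fineUniformSpace X)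

variable (G : Type*) [Group G] [TopologicalSpace G] [IsTopologicalGroup G]

instance : T0Space (RaikovCompletion G) :=
  @UniformSpace.Completion.t0Space G (twoSidedUniformSpace G)

theorem isDenseInducing_toRaikov : IsDenseInducing (toRaikov G) :=
  isDenseInducing_completion_coe _ (twoSidedUniformSpace_toTopologicalSpace G)

theorem isDenseInducing_toRaikovOmega : IsDenseInducing (toRaikovOmega G) :=
  isDenseInducing_codRestrict (isDenseInducing_toRaikov G).isInducing _ fun y _ =>
    (isDenseInducing_toRaikov G).dense y

variable {G}

theorem exists_tendsto_toRaikovOmega {F : Filter G} (hF : HasCountableIntersections F)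
    (hc : Cauchy (uniformSpace := twoSidedUniformSpace G) F) :
    ∃ z, Tendsto (toRaikovOmega G) F (𝓝 z) := by
  obtain ⟨z, hz⟩ : ∃ z, Tendsto (toRaikov G) F (𝓝 z) :=
    @exists_tendsto_completion_coe G (twoSidedUniformSpace G) F hc
  exact ⟨⟨z, mem_gDeltaClosure_range_iff.2 (hF.mono hz.le_comap)⟩, tendsto_subtype_rng.2 hz⟩

end Completion

section SimplySMFactorizable

variable {G : Type*} [Group G] [TopologicalSpace G] [IsTopologicalGroup G]

theorem IsSimplySMFactorizable.exists_tendsto_comap_toRaikovOmega (hG : IsSimplySMFactorizable G)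
    (y : RaikovOmega G) {f : G → ℝ} (hf : Continuous f) :
    ∃ c, Tendsto f (comap (toRaikovOmega G) (𝓝 y)) (𝓝 c) := by
  have hy : comap (toRaikovOmega G) (𝓝 y) = comap (toRaikov G) (𝓝 y.1) :=
    comap_codRestrict_nhds _ y
  rw [hy]
  exact hG.exists_tendsto_of_cauchy (mem_gDeltaClosure_range_iff.1 y.2)
    (@cauchy_comap_completion_coe G (twoSidedUniformSpace G) y.1) hf

theorem IsSimplySMFactorizable.exists_homeomorph_raikovOmega (hG : IsSimplySMFactorizable G) :
    ∃ k : RaikovOmega G ≃ₜ Realcompactification G,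
      ∀ x : G, k (toRaikovOmega G x) = toRealcompactification G x := by
  have := completelyRegularSpace_of_isTopologicalGroup G
  have hd := isDenseInducing_toRaikovOmega G
  refine exists_homeomorph_of_isDenseInducing hd
    (isDenseInducing_toRealcompactification G) (fun y => ?_) fun z => ?_
  · have := hd.comap_nhds_neBot y
    exact exists_tendsto_toRealcompactification fun f => hG.exists_tendsto_comap_toRaikovOmega y
  · rw [comap_toRealcompactification_nhds]
    exact exists_tendsto_toRaikovOmega (hasCountableIntersections_evalFilter z.2)
      (hG.cauchy_twoSided_evalFilter z.2)

theorem IsSimplySMFactorizable.exists_homeomorph_dieudonneCompletion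
    (hG : IsSimplySMFactorizable G) :
    ∃ l : DieudonneCompletion G ≃ₜ Realcompactification G,
      ∀ x : G, l (toDieudonne G x) = toRealcompactification G x := by
  have := completelyRegularSpace_of_isTopologicalGroup G
  refine exists_homeomorph_of_isDenseInducing (i := toDieudonne G)
    (isDenseInducing_completion_coe _ (fineUniformSpace_toTopologicalSpace G))
    (isDenseInducing_toRealcompactification G) (fun y => ?_) fun z => ?_
  · have hy : Cauchy (uniformSpace := fineUniformSpace G) (comap (toDieudonne G) (𝓝 y)) :=
      @cauchy_comap_completion_coe G (fineUniformSpace G) y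
    have := hy.1
    exact exists_tendsto_toRealcompactification fun f => exists_tendsto_of_cauchy_fine hy
  · rw [comap_toRealcompactification_nhds]
    exact @exists_tendsto_completion_coe G (fineUniformSpace G) _ (hG.cauchy_fine_evalFilter z.2)

theorem IsSimplySMFactorizable.isCompletionFriendly [T2Space G] (hG : IsSimplySMFactorizable G) :
    IsCompletionFriendly G := by
  have hd := isDenseInducing_toRaikovOmega G
  exact ⟨hd.isInducing.isEmbedding, fun f hf => ⟨hd.extend f,
    hd.continuous_extend fun y => hG.exists_tendsto_comap_toRaikovOmega y hf, hd.extend_eq hf⟩⟩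

theorem IsSimplySMFactorizable.exists_continuous_mul_realcompactification
    (hG : IsSimplySMFactorizable G) :
    ∃ m : Realcompactification G × Realcompactification G → Realcompactification G,
      Continuous m ∧ ∀ x y : G, m (toRealcompactification G x, toRealcompactification G y) =
        toRealcompactification G (x * y) := by
  have := completelyRegularSpace_of_isTopologicalGroup G
  have hd := isDenseInducing_toRealcompactification G
  have hd₂ := hd.prodMap hd
  refine ⟨hd₂.extend fun x => toRealcompactification G (x.1 * x.2),
    hd₂.continuous_extend fun y => ?_,
    fun x y => hd₂.extend_eq (hd.continuous.comp continuous_mul) (x, y)⟩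
  have := hd₂.comap_nhds_neBot y
  have hy : comap (Prod.map (toRealcompactification G) (toRealcompactification G)) (𝓝 y) =
      evalFilter y.1.1 ×ˢ evalFilter y.2.1 := by
    rw [nhds_prod_eq, comap_prodMap_prod, comap_toRealcompactification_nhds,
      comap_toRealcompactification_nhds]
  refine exists_tendsto_toRealcompactification fun f hf => ?_
  obtain ⟨N, _, hQ, f', hf', hff'⟩ := hG.exists_factorization hf
  have := completelyRegularSpace_of_isTopologicalGroup (G ⧸ N)
  obtain ⟨g, hg⟩ := hQ.exists_tendsto_evalFilter y.1.2 QuotientGroup.continuous_mk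
  obtain ⟨h, hh⟩ := hQ.exists_tendsto_evalFilter y.2.2 QuotientGroup.continuous_mk
  rw [hy]
  exact ⟨f' (g * h), ((hf'.tendsto _).comp
    ((hg.comp tendsto_fst).mul (hh.comp tendsto_snd))).congr fun x => hff' (x.1 * x.2)⟩

theorem IsSimplySMFactorizable.isPTGroup (hG : IsSimplySMFactorizable G) : IsPTGroup G := by
  have := completelyRegularSpace_of_isTopologicalGroup G
  obtain ⟨l, hl⟩ := hG.exists_homeomorph_dieudonneCompletion
  have hl' (x : G) : l.symm (toRealcompactification G x) = toDieudonne G x := by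
    rw [← hl, l.symm_apply_apply]
  obtain ⟨m, hm, hmx⟩ := hG.exists_continuous_mul_realcompactification
  obtain ⟨j, hj, hjx⟩ := exists_continuous_extension_realcompactification
    (continuous_inv (G := G))
  exact ⟨⟨fun z => l.symm (m (l z.1, l z.2)), by fun_prop, fun x y => by simp only [hl, hmx, hl']⟩,
    fun z => l.symm (j (l z)), by fun_prop, fun x => by simp only [hl, hjx, hl']⟩

end SimplySMFactorizable

end SMFactor

theorem theorem3p2 {G : Type*} [Group G] [TopologicalSpace G] [IsTopologicalGroup G] [T2Space G]
    (hG : SMFactor.IsSimplySMFactorizable G) :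
    (∃ h : SMFactor.DieudonneCompletion G ≃ₜ SMFactor.RaikovOmega G,
      ∀ x : G, h (SMFactor.toDieudonne G x) = SMFactor.toRaikovOmega G x) ∧
    (∃ k : SMFactor.RaikovOmega G ≃ₜ SMFactor.Realcompactification G,
      ∀ x : G, k (SMFactor.toRaikovOmega G x) = SMFactor.toRealcompactification G x) ∧
    SMFactor.IsCompletionFriendly G ∧
    SMFactor.IsPTGroup G := by
  obtain ⟨k, hk⟩ := hG.exists_homeomorph_raikovOmega
  obtain ⟨l, hl⟩ := hG.exists_homeomorph_dieudonneCompletion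
  exact ⟨⟨l.trans k.symm, fun x => by rw [Homeomorph.trans_apply, hl, ← hk, k.symm_apply_apply]⟩,
    ⟨k, hk⟩, hG.isCompletionFriendly, hG.isPTGroup⟩
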